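/- **Notation.** For a set $X$ and $\mathcal A\subseteq\mathcal P(X)$ let $\mathcal A^\star=\{X\setminus A: A\in\mathcal A\}$. For ideals $\mathcal I$ on $X$ and $\mathcal J$ on $Y$, $\mathcal J$ *contains an isomorphic copy of* $\mathcal I$, written $\mathcal I\sqsubseteq\mathcal J$, if there is a bijection $f:Y\to X$ with $f^{-1}[A]\in\mathcal J$ for every $A\in\mathcal I$. Let $\mathrm{Fin}^1=\mathrm{Fin}$ be the ideal of finite subsets of $\omega$ and, for $n\ge 1$, let $\mathrm{Fin}^{n+1}=\mathrm{Fin}\otimes\mathrm{Fin}^n$ be the ideal on $\omega^{n+1}=\omega\times\omega^n$ consisting of all $A$ such that $\{i\in\omega:\{x\in\omega^n:(i,x)\in A\}\notin\mathrm{Fin}^n\}$ is finite. For $0<i\le j<\omega$ let $\pi_{i,j}:\omega^j\to\omega^i$, $\pi_{i,j}(x_0,\dots,x_{j-1})=(x_{j-i},\dots,x_{j-1})$, be the projection onto the last $i$ coordinates. Let $\mathrm{Fin}_\omega$ be the inductive limit of the ideals $\mathrm{Fin}^i$ along these maps, i.e. the ideal on the disjoint sum $\sum_{i>0}\omega^i$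 consisting of all $M$ for which there are $i>0$ and $P\in(\mathrm{Fin}^i)^\star$ with $$M\cap\sum_{j\ge i}\pi_{i,j}^{-1}[P]=\emptyset.$$ Let $\{\{X_s:s\in\omega^{n+1}\}:n\in\omega\}$ be a family of partitions of $\omega$ into infinite sets (for each $n$, $\{X_s:s\in\omega^{n+1}\}$ is a partition of $\omega$ into infinite sets) such that $\bigcap_{i\in F}X_{s_i}$ is infinite for every finite $F\subseteq\omega$ and all $s_i\in\omega^{i+1}$, $i\in F$. For each $n$ let $\mathrm{Fin}^{n+2}(\{X_s:s\in\omega^{n+1}\})=\{A\subseteq\omega:\sigma^{-1}[A]\in\mathrm{Fin}^{n+2}\}$, where $\sigma:\omega^{n+2}\to\omega$ is any bijection with $\sigma[\{s\}\times\omega]=X_s$ for all $s\in\omega^{n+1}$ (the choice of $\sigma$ does not matter). Let $\mathrm{Fin}'_\omega$ be the ideal on $\omega$ generated by $\bigcup_{n\in\omega}\mathrm{Fin}^{n+2}(\{X_s:s\in\omega^{n+1}\})$, i.e. the family of all subsets of finite unions of its members. **Theorem.** For every such family of partitions, $\mathrm{Fin}_\omega\not\sqsubseteq\mathrm{Fin}'_\omega$: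 the ideal $\mathrm{Fin}'_\omega$ does not contain an isomorphic copy of $\mathrm{Fin}_\omega$. -/

import Mathlib

/-- The dual family `𝓐⋆ = {X \ A : A ∈ 𝓐}`. -/
def dualFamily {X : Type*} (𝓐 : Set (Set X)) : Set (Set X) :=
  {B | Bᶜ ∈ 𝓐}

/-- `J` contains an isomorphic copy of `I`, written `I ⊑ J`: there is a bijection
`f : dom J → dom I` with `f⁻¹[A] ∈ J` for every `A ∈ I`. -/
def ContainsCopy {X Y : Type*} (J : Set (Set Y)) (I : Set (Set X)) : Prop :=
  ∃ f : Y ≃ X, ∀ A ∈ I, f ⁻¹' A ∈ J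

/-- The family (ideal) of subsets of `X` generated by `𝓕`: all subsets of unions
`F₀ ∪ ⋯ ∪ Fₙ` of members of `𝓕`. -/
def generatedIdeal {X : Type*} (𝓕 : Set (Set X)) : Set (Set X) :=
  {A | ∃ (n : ℕ) (F : Fin (n + 1) → Set X), (∀ k, F k ∈ 𝓕) ∧ A ⊆ ⋃ k, F k}

/-- The ideal of finite subsets of `ω`. -/
def finIdeal : Set (Set ℕ) := {A | A.Finite}

/-- The Fubini product `I ⊗ J` on `X × Y`. -/
def fubiniProd {X Y : Type*} (I : Set (Set X)) (J : Set (Set Y)) : Set (Set (X × Y)) :=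
  {A | {x | {y | (x, y) ∈ A} ∉ J} ∈ I}

/-- The ideals `Fin^n` on `ω^n`, with `Fin^(n+1) = Fin ⊗ Fin^n`, where `ω × ω^n` is identified
with `ω^(n+1)` by prepending the first coordinate. The recursion starts at the auxiliary value
`Fin^0 = {∅}` on the one-point set `ω^0`, which gives `Fin^1 = Fin` (see `mem_finPow_one`);
only `n ≥ 1` is used below. -/
def finPow : (n : ℕ) → Set (Set (Fin n → ℕ))
  | 0 => {∅}
  | n + 1 => {A | (fun p : ℕ × (Fin n → ℕ) => (Fin.cons p.1 p.2 : Fin (n + 1) → ℕ)) ⁻¹' A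
      ∈ fubiniProd finIdeal (finPow n)}

theorem mem_finPow_one (A : Set ℕ) :
    {x : Fin 1 → ℕ | x 0 ∈ A} ∈ finPow 1 ↔ A ∈ finIdeal := by
  have h : {i : ℕ | {y : Fin 0 → ℕ | i ∈ A} ∉ ({∅} : Set (Set (Fin 0 → ℕ)))} = A := by
    ext i
    by_cases hi : i ∈ A <;> simp [hi]
  simp only [finPow, fubiniProd, Set.mem_ofPred_eq, Set.mem_preimage, Fin.cons_zero]
  rw [h]

/-- The inductive limit of a system of families `I i` of subsets of `D i`, with connecting maps
`π i j : D j → D i` for `i ≤ j` (defined on all of `D j`). It consists of the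
`M ⊆ ∑ᵢ D i` such that, for some `i` and some `P ∈ (I i)⋆`, the set `M` is disjoint
from `∑_{j ≥ i} (π i j)⁻¹[P]`. -/
def inductiveLimit {ι : Type*} [Preorder ι] {D : ι → Type*} (I : ∀ i, Set (Set (D i)))
    (π : ∀ i j, i ≤ j → D j → D i) : Set (Set (Σ i, D i)) :=
  {M | ∃ i, ∃ P ∈ dualFamily (I i),
    M ∩ {p : Σ i, D i | ∃ h : i ≤ p.1, π i p.1 h p.2 ∈ P} = ∅}

/-- The projection `ω^j → ω^i` onto the last `i` coordinates,
`(x₀, …, x_{j-1}) ↦ (x_{j-i}, …, x_{j-1})`. -/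
def lastCoords (i j : ℕ) (h : i ≤ j) (x : Fin j → ℕ) : Fin i → ℕ :=
  fun l => x ⟨j - i + l, by have := l.isLt; omega⟩

/-- `Fin_ω`, the inductive limit of the ideals `Fin^i`, `0 < i < ω`, along the projections onto
the last coordinates; it lives on the disjoint sum of the sets `ω^i`, `0 < i < ω`. -/
def finOmega : Set (Set (Σ i : ℕ+, (Fin (i : ℕ) → ℕ))) :=
  inductiveLimit (fun i : ℕ+ => finPow (i : ℕ))
    (fun i j h => lastCoords (i : ℕ) (j : ℕ) h)

/-- `{{X_s : s ∈ ω^(n+1)} : n ∈ ω}` is a family of partitions of `ω` into infinite sets such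
that `⋂_{i ∈ F} X_{s_i}` is infinite for all finite `F ⊆ ω` and `s_i ∈ ω^(i+1)`, `i ∈ F`. -/
structure IsIndependentPartitionFamily (X : (n : ℕ) → (Fin (n + 1) → ℕ) → Set ℕ) : Prop where
  infinite : ∀ n s, (X n s).Infinite
  disjoint : ∀ n s t, s ≠ t → Disjoint (X n s) (X n t)
  cover : ∀ n, ⋃ s, X n s = Set.univ
  infinite_inter : ∀ (F : Finset ℕ) (s : (i : ℕ) → (Fin (i + 1) → ℕ)),
    (⋂ i ∈ F, X i (s i)).Infinite

/-- Such families exist. -/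
theorem exists_isIndependentPartitionFamily :
    ∃ X : (n : ℕ) → (Fin (n + 1) → ℕ) → Set ℕ, IsIndependentPartitionFamily X := by
  classical
  let T := (Π₀ n : ℕ, (Fin (n + 1) → ℕ)) × ℕ
  have : Countable (Π₀ n : ℕ, (Fin (n + 1) → ℕ)) := by
    let g : (Σ F : Finset ℕ, ((i : F) → (Fin ((i : ℕ) + 1) → ℕ))) →
      (Π₀ n : ℕ, (Fin (n + 1) → ℕ)) := fun p => DFinsupp.mk p.1 p.2
    refine Function.Surjective.countable (f := g) fun d => ⟨⟨d.support, fun i => d i⟩, ?_⟩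
    ext1 i
    by_cases h : d i = 0 <;> simp [g, h]
  have : Infinite T := inferInstanceAs (Infinite ((Π₀ n : ℕ, (Fin (n + 1) → ℕ)) × ℕ))
  have : Countable T := inferInstanceAs (Countable ((Π₀ n : ℕ, (Fin (n + 1) → ℕ)) × ℕ))
  obtain ⟨e⟩ : Nonempty (ℕ ≃ T) := nonempty_equiv_of_countable
  have key : ∀ (F : Finset ℕ) (s : (i : ℕ) → (Fin (i + 1) → ℕ)),
      (⋂ i ∈ F, {x : ℕ | (e x).1 i = s i}).Infinite := by
    intro F s
    refine Set.infinite_of_injective_forall_mem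
      (f := fun k : ℕ => e.symm (DFinsupp.mk F fun i => s i, k)) ?_ ?_
    · intro a b h
      exact congrArg Prod.snd (e.symm.injective h)
    · intro k
      simp only [Set.mem_iInter, Set.mem_ofPred_eq, Equiv.apply_symm_apply]
      intro i hi
      simp [hi]
  refine ⟨fun n s => {x | (e x).1 n = s}, ⟨fun n s => ?_, ?_, ?_, key⟩⟩
  · have h := key {n} (Function.update (fun _ => 0) n s)
    simpa using h
  · intro n s t hst
    refine Set.disjoint_left.2 fun x hx hy => hst ?_
    exact hx.symm.trans hy
  · intro n
    ext x
    simp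

/-- `Fin^(n+2)({X_s : s ∈ ω^(n+1)})`: the copy of `Fin^(n+2)` on `ω` given by a bijection
`σ : ω^(n+2) → ω` with `σ[{s} × ω] = X_s` for all `s ∈ ω^(n+1)`. All such bijections give the
same family; `Fin.init x` is `x` without its last coordinate. -/
def finPowCopy (n : ℕ) (X : (Fin (n + 1) → ℕ) → Set ℕ) : Set (Set ℕ) :=
  {A | ∃ σ : (Fin (n + 2) → ℕ) ≃ ℕ,
    (∀ s : Fin (n + 1) → ℕ, σ '' {x | (Fin.init x : Fin (n + 1) → ℕ) = s} = X s) ∧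
      σ ⁻¹' A ∈ finPow (n + 2)}

/-- `Fin'_ω`, for a given family `X` of partitions: the ideal on `ω` generated by
`⋃ₙ Fin^(n+2)({X_s : s ∈ ω^(n+1)})`. -/
def finOmega' (X : (n : ℕ) → (Fin (n + 1) → ℕ) → Set ℕ) : Set (Set ℕ) :=
  generatedIdeal (⋃ n, finPowCopy n (X n))

open Filter

/-! ### The ideals `Fin^n` -/

/-! Suppose `f` witnesses a copy, and let `y i x` be the `i`-th coordinate of `f x` counted from the
end. For every `m`, the tuple `(y m, …, y 0)` then pulls `Fin^(m+1)` back into `Fin'_ω`. List the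
coordinates of the indices of a point in all the partitions as one sequence `z`. Every member of
`Fin'_ω` is small: for some `q` it meets almost every cylinder of length `q` in a finite set, where
"almost every" is iterated entry by entry. Even modulo small sets no such `y` exists
(`not_forall_smallBelow_preimage`).

Indeed, the case `Fin^2` makes `y 1` bounded on frequently many cylinders of some length `r`
(`exists_frequently_bounded`). Off a small set, `y i < y 1` for each `i ≥ 2`. So on such a cylinder
`l` the tuple `u = (y (r+1), …, y 1)` takes finitely many values up to a small set, and its fibre
over some value `c l` is not small below `l`. These `(r+1)`-tuples are indexed by only `r` iterated
limits, so frequently many of them form a set in `Fin^(r+1)` (`exists_frequently_image_mem_finPow`).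
The preimage of that set under `u` must be small, yet it contains the fibres over the chosen values.
-/

theorem finPow_succ_iff {n : ℕ} {A : Set (Fin (n + 1) → ℕ)} :
    A ∈ finPow (n + 1) ↔
      ∀ᶠ a in atTop, {v : Fin n → ℕ | (Fin.cons a v : Fin (n + 1) → ℕ) ∈ A} ∈ finPow n := by
  rw [← Nat.cofinite_eq_atTop, Filter.eventually_cofinite]
  rfl

theorem finPow_mono {n : ℕ} {A B : Set (Fin n → ℕ)} (h : A ⊆ B) (hB : B ∈ finPow n) :
    A ∈ finPow n := by
  induction n with
  | zero =>
    have hB' : B = ∅ := hB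
    exact Set.subset_empty_iff.1 (hB' ▸ h)
  | succ n ih =>
    rw [finPow_succ_iff] at hB ⊢
    filter_upwards [hB] with a ha
    exact ih (fun v hv => h hv) ha

theorem finPow_empty (n : ℕ) : (∅ : Set (Fin n → ℕ)) ∈ finPow n := by
  induction n with
  | zero => rfl
  | succ n ih =>
    rw [finPow_succ_iff]
    exact Eventually.of_forall fun a => ih

theorem finPow_union {n : ℕ} {A B : Set (Fin n → ℕ)} (hA : A ∈ finPow n) (hB : B ∈ finPow n) :
    A ∪ B ∈ finPow n := by
  induction n with
  | zero =>
    have hA' : A = ∅ := hA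
    have hB' : B = ∅ := hB
    subst hA' hB'
    exact Set.union_empty _
  | succ n ih =>
    rw [finPow_succ_iff] at *
    filter_upwards [hA, hB] with a ha hb
    exact ih ha hb

theorem finPow_biUnion_lt {n : ℕ} (A : ℕ → Set (Fin n → ℕ)) (hA : ∀ k, A k ∈ finPow n) (N : ℕ) :
    {v | ∃ k < N, v ∈ A k} ∈ finPow n := by
  induction N with
  | zero => exact finPow_mono (by rintro v ⟨k, hk, -⟩; omega) (finPow_empty n)
  | succ N ih =>
    refine finPow_mono ?_ (finPow_union ih (hA N))
    rintro v ⟨k, hk, hv⟩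
    rcases Nat.lt_succ_iff_lt_or_eq.1 hk with h | rfl
    · exact Or.inl ⟨k, h, hv⟩
    · exact Or.inr hv

theorem finPow_coord_le {n : ℕ} (j : Fin n) (a : ℕ) : {v : Fin n → ℕ | v j ≤ a} ∈ finPow n := by
  induction n with
  | zero => exact j.elim0
  | succ n ih =>
    rw [finPow_succ_iff]
    refine Fin.cases ?_ (fun j => ?_) j
    · filter_upwards [eventually_gt_atTop a] with b hb
      refine finPow_mono (fun v hv => ?_) (finPow_empty n)
      simp only [Set.mem_ofPred_eq, Fin.cons_zero] at hv
      omega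
    · refine Eventually.of_forall fun b => ?_
      simpa using ih j

/-- On each slice the bound is a constant. Hence, modulo `Fin^(n+1)`, every later coordinate
dominates any function of the first one. -/
theorem finPow_coord_le_zero {n : ℕ} (j : Fin n) (h : ℕ → ℕ) :
    {v : Fin (n + 1) → ℕ | v j.succ ≤ h (v 0)} ∈ finPow (n + 1) := by
  rw [finPow_succ_iff]
  refine Eventually.of_forall fun b => ?_
  simpa using finPow_coord_le j (h b)

theorem finPow_init {n : ℕ} {T : Set (Fin n → ℕ)} (hT : T ∈ finPow n) :
    {v : Fin (n + 1) → ℕ | (Fin.init v : Fin n → ℕ) ∈ T} ∈ finPow (n + 1) := by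
  induction n with
  | zero =>
    have hT' : T = ∅ := hT
    subst hT'
    exact finPow_empty 1
  | succ n ih =>
    rw [finPow_succ_iff] at *
    filter_upwards [hT] with a ha
    refine finPow_mono (fun v hv => ?_) (ih ha)
    simp only [Set.mem_ofPred_eq] at hv ⊢
    convert hv using 1
    ext i
    refine Fin.cases ?_ (fun i => ?_) i <;> simp [Fin.init]

/-- Transported to `ω` by `σ`, the fibres become the cells of a partition, so a set in the copy of
`Fin^(n+2)` meets almost all cells in finite sets. -/
theorem finPow_infinite_fibers {n : ℕ} {T : Set (Fin (n + 1) → ℕ)} (hT : T ∈ finPow (n + 1)) :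
    {s : Fin n → ℕ | {b : ℕ | (Fin.snoc s b : Fin (n + 1) → ℕ) ∈ T}.Infinite} ∈ finPow n := by
  induction n with
  | zero =>
    refine Set.eq_empty_of_forall_notMem fun s hs => hs ?_
    rw [finPow_succ_iff, ← Nat.cofinite_eq_atTop, Filter.eventually_cofinite] at hT
    refine hT.subset fun b hb h0 => ?_
    have h0' : {v : Fin 0 → ℕ | (Fin.cons b v : Fin 1 → ℕ) ∈ T} = ∅ := h0
    refine Set.eq_empty_iff_forall_notMem.1 h0' s ?_
    simp only [Set.mem_ofPred_eq] at hb ⊢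
    convert hb using 1
    ext i
    fin_cases i
    simp [Fin.snoc]
  | succ n ih =>
    rw [finPow_succ_iff] at hT
    rw [finPow_succ_iff]
    filter_upwards [hT] with a ha
    refine finPow_mono (fun s hs => ?_) (ih ha)
    simpa only [Set.mem_ofPred_eq, Fin.cons_snoc_eq_snoc_cons] using hs

/-! ### Iterated cofinite filters on finite sequences -/

/-- The filter of sets containing almost all extensions of `l` by `q` entries, where
"almost all" is iterated entry by entry. -/
def prefixFilter : ℕ → List ℕ → Filter (List ℕ)
  | 0, l => pure l
  | q + 1, l => atTop.bind fun a => prefixFilter q (l ++ [a])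

theorem eventually_prefixFilter_succ {q : ℕ} {l : List ℕ} {P : List ℕ → Prop} :
    (∀ᶠ l' in prefixFilter (q + 1) l, P l') ↔
      ∀ᶠ a in atTop, ∀ᶠ l' in prefixFilter q (l ++ [a]), P l' :=
  Filter.eventually_bind

theorem frequently_prefixFilter_succ {q : ℕ} {l : List ℕ} {P : List ℕ → Prop} :
    (∃ᶠ l' in prefixFilter (q + 1) l, P l') ↔
      ∃ᶠ a in atTop, ∃ᶠ l' in prefixFilter q (l ++ [a]), P l' := by
  simp only [Filter.Frequently, eventually_prefixFilter_succ, not_not]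

theorem eventually_prefixFilter_add {q k : ℕ} {l : List ℕ} {P : List ℕ → Prop} :
    (∀ᶠ l' in prefixFilter (q + k) l, P l') ↔
      ∀ᶠ l₁ in prefixFilter q l, ∀ᶠ l' in prefixFilter k l₁, P l' := by
  induction q generalizing l with
  | zero => simp [prefixFilter]
  | succ q ih =>
    rw [Nat.add_right_comm, eventually_prefixFilter_succ, eventually_prefixFilter_succ]
    simp only [ih]

instance prefixFilter_neBot (q : ℕ) (l : List ℕ) : (prefixFilter q l).NeBot := by
  induction q generalizing l with
  | zero => exact Filter.pure_neBot
  | succ q ih =>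
    refine ⟨fun h => ?_⟩
    have h' : ∀ᶠ _ in prefixFilter (q + 1) l, False := by rw [h]; exact eventually_bot
    rw [eventually_prefixFilter_succ] at h'
    obtain ⟨a, ha⟩ := h'.exists
    have := ih (l ++ [a])
    exact ha.exists.elim fun _ h => h

theorem eventually_prefixFilter_prefix (q : ℕ) (l : List ℕ) :
    ∀ᶠ l' in prefixFilter q l, l <+: l' ∧ l'.length = l.length + q := by
  induction q generalizing l with
  | zero => simp [prefixFilter]
  | succ q ih =>
    rw [eventually_prefixFilter_succ]
    refine Eventually.of_forall fun a => ?_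
    filter_upwards [ih (l ++ [a])] with l' hl'
    refine ⟨(List.prefix_append l [a]).trans hl'.1, ?_⟩
    rw [hl'.2]
    simp
    omega

/-- The dual filter of `Fin^m` and `prefixFilter m` unfold to the same iteration of cofinite
quantifiers, one on tuples and one on lists. -/
theorem eventually_prefixFilter_of_finPow {m : ℕ} {T : Set (Fin m → ℕ)} (hT : T ∈ finPow m)
    {l : List ℕ} {Q : List ℕ → Prop} (hQ : ∀ v, v ∉ T → Q (l ++ List.ofFn v)) :
    ∀ᶠ l' in prefixFilter m l, Q l' := by
  induction m generalizing l with
  | zero =>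
    have hT' : T = ∅ := hT
    subst hT'
    have := hQ Fin.elim0 (Set.notMem_empty _)
    simpa [prefixFilter] using this
  | succ m ih =>
    rw [eventually_prefixFilter_succ]
    rw [finPow_succ_iff] at hT
    filter_upwards [hT] with a ha
    refine ih ha fun v hv => ?_
    have := hQ (Fin.cons a v) hv
    simpa [List.ofFn_succ] using this

/-- `Fin^m` does not reduce to an iteration of fewer than `m` cofinite filters. -/
theorem exists_frequently_image_mem_finPow {r m : ℕ} (hrm : r < m) (l : List ℕ)
    (D : Set (List ℕ)) (c : List ℕ → Fin m → ℕ) (hD : ∃ᶠ l' in prefixFilter r l, l' ∈ D) :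
    ∃ E ⊆ D, (∃ᶠ l' in prefixFilter r l, l' ∈ E) ∧ c '' E ∈ finPow m := by
  induction r generalizing l m D with
  | zero =>
    refine ⟨{l}, ?_, by simp [prefixFilter], ?_⟩
    · simpa [prefixFilter] using hD
    · refine finPow_mono ?_ (finPow_coord_le (⟨0, hrm⟩ : Fin m) (c l ⟨0, hrm⟩))
      rintro _ ⟨l', rfl, rfl⟩
      exact le_refl (c l' ⟨0, hrm⟩)
  | succ r ih =>
    obtain ⟨m, rfl⟩ : ∃ m', m = m' + 1 := ⟨m - 1, by omega⟩
    -- If the first coordinate of `c` is frequently a constant, the corresponding part of `D`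
    -- already works. Otherwise it frequently exceeds any bound, and the tails are handled by
    -- induction.
    by_cases hc : ∃ w, ∃ᶠ l' in prefixFilter (r + 1) l, l' ∈ D ∧ c l' 0 = w
    · obtain ⟨w, hw⟩ := hc
      refine ⟨{l' | l' ∈ D ∧ c l' 0 = w}, fun l' h => h.1, hw, ?_⟩
      refine finPow_mono ?_ (finPow_coord_le 0 w)
      rintro _ ⟨l', h, rfl⟩
      exact h.2.le
    · have hgt : ∀ w, ∃ᶠ l' in prefixFilter (r + 1) l, l' ∈ D ∧ w ≤ c l' 0 := by
        intro w
        have h1 : ∀ᶠ l' in prefixFilter (r + 1) l, ∀ i ∈ Finset.range w, ¬ (l' ∈ D ∧ c l' 0 = i) := by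
          rw [Filter.eventually_all_finset]
          intro i _
          exact not_frequently.1 fun h => hc ⟨i, h⟩
        refine (hD.and_eventually h1).mono fun l' h => ⟨h.1, ?_⟩
        by_contra! hlt
        exact h.2 _ (Finset.mem_range.2 hlt) ⟨h.1, rfl⟩
      -- The bound `a ≥ w` keeps the union of the sets `E w` frequent; the bound `w ≤ c l' 0` lets
      -- only finitely many `w` contribute to each slice of the image.
      have hstep : ∀ w, ∃ a ≥ w, ∃ E ⊆ {l' | l' ∈ D ∧ w ≤ c l' 0},
          (∃ᶠ l' in prefixFilter r (l ++ [a]), l' ∈ E) ∧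
            (fun l' => Fin.tail (c l')) '' E ∈ finPow m := by
        intro w
        obtain ⟨a, ha, h⟩ := frequently_atTop.1 (frequently_prefixFilter_succ.1 (hgt w)) w
        exact ⟨a, ha, ih (Nat.lt_of_succ_lt_succ hrm) _ _ _ h⟩
      choose a ha E hED hE hcE using hstep
      refine ⟨⋃ w, E w, Set.iUnion_subset fun w l' h => (hED w h).1, ?_, ?_⟩
      · rw [frequently_prefixFilter_succ, frequently_atTop]
        exact fun w => ⟨a w, ha w, (hE w).mono fun l' h => Set.mem_iUnion.2 ⟨w, h⟩⟩
      · rw [finPow_succ_iff]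
        refine Eventually.of_forall fun b => ?_
        refine finPow_mono ?_ (finPow_biUnion_lt _ hcE (b + 1))
        rintro v ⟨l', hl', hv⟩
        obtain ⟨w, hw⟩ := Set.mem_iUnion.1 hl'
        refine ⟨w, ?_, l', hw, ?_⟩
        · have h1 : w ≤ c l' 0 := (hED w hw).2
          rw [hv, Fin.cons_zero] at h1
          omega
        · simp [hv]

/-! ### Small sets with respect to a sequence of coordinate functions -/

/-- The points whose sequence of coordinates `z 0 x, z 1 x, …` starts with `l`. -/
def cylinder (z : ℕ → ℕ → ℕ) (l : List ℕ) : Set ℕ :=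
  {x | ∀ (k : ℕ) (h : k < l.length), z k x = l[k]}

theorem cylinder_anti {z : ℕ → ℕ → ℕ} {l l' : List ℕ} (h : l <+: l') :
    cylinder z l' ⊆ cylinder z l := fun x hx k hk => by
  rw [hx k (hk.trans_le h.length_le)]
  exact (h.getElem hk).symm

/-- `B` is small below `l`: for some `q`, almost all extensions of `l` by `q` entries determine
a cylinder meeting `B` in a finite set. -/
def SmallBelow (z : ℕ → ℕ → ℕ) (l : List ℕ) (B : Set ℕ) : Prop :=
  ∃ q, ∀ᶠ l' in prefixFilter q l, (B ∩ cylinder z l').Finite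

section SmallBelow

variable {z : ℕ → ℕ → ℕ}

theorem eventually_finite_add {l : List ℕ} {B : Set ℕ} {q : ℕ}
    (h : ∀ᶠ l' in prefixFilter q l, (B ∩ cylinder z l').Finite) (k : ℕ) :
    ∀ᶠ l' in prefixFilter (q + k) l, (B ∩ cylinder z l').Finite := by
  rw [eventually_prefixFilter_add]
  filter_upwards [h] with l₁ h₁
  filter_upwards [eventually_prefixFilter_prefix k l₁] with l' hl'
  exact h₁.subset (Set.inter_subset_inter_right _ (cylinder_anti hl'.1))

theorem SmallBelow.mono {l : List ℕ} {A B : Set ℕ} (hB : SmallBelow z l B) (h : A ⊆ B) :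
    SmallBelow z l A := by
  obtain ⟨q, hq⟩ := hB
  exact ⟨q, hq.mono fun l' hl' => hl'.subset (Set.inter_subset_inter_left _ h)⟩

theorem SmallBelow.union {l : List ℕ} {A B : Set ℕ} (hA : SmallBelow z l A)
    (hB : SmallBelow z l B) : SmallBelow z l (A ∪ B) := by
  obtain ⟨q, hq⟩ := hA
  obtain ⟨k, hk⟩ := hB
  refine ⟨q + k, ?_⟩
  filter_upwards [eventually_finite_add hq k, q.add_comm k ▸ eventually_finite_add hk q]
    with l' h1 h2
  rw [Set.union_inter_distrib_right]
  exact h1.union h2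

theorem smallBelow_empty (l : List ℕ) : SmallBelow z l ∅ :=
  ⟨0, Eventually.of_forall fun l' => by simp⟩

theorem SmallBelow.biUnion {ι : Type*} {l : List ℕ} {S : Set ι} (hS : S.Finite) {A : ι → Set ℕ}
    (hA : ∀ i ∈ S, SmallBelow z l (A i)) : SmallBelow z l (⋃ i ∈ S, A i) := by
  induction S, hS using Set.Finite.induction_on with
  | empty => simpa using smallBelow_empty l
  | insert _ _ ih =>
    rw [Set.biUnion_insert]
    exact (hA _ (Set.mem_insert _ _)).union (ih fun i hi => hA i (Set.mem_insert_of_mem _ hi))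

/-- The witness `q` may be enlarged to `r + q`, after which the first `r` entries split off. -/
theorem SmallBelow.eventually {l : List ℕ} {B : Set ℕ} (hB : SmallBelow z l B) (r : ℕ) :
    ∀ᶠ l' in prefixFilter r l, SmallBelow z l' B := by
  obtain ⟨q, hq⟩ := hB
  have h := eventually_finite_add hq r
  rw [add_comm, eventually_prefixFilter_add] at h
  exact h.mono fun l' hl' => ⟨q, hl'⟩

theorem not_smallBelow_cylinder (hz : ∀ l, (cylinder z l).Infinite) (l : List ℕ) :
    ¬ SmallBelow z l (cylinder z l) := by
  rintro ⟨q, hq⟩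
  obtain ⟨l', hfin, hl'⟩ := (hq.and (eventually_prefixFilter_prefix q l)).exists
  rw [Set.inter_eq_right.2 (cylinder_anti hl'.1)] at hfin
  exact hz l' hfin

/-- If `{x | y₀ x ≤ h (y₁ x)}` is small for all `h`, then `y₁` is bounded on frequently many
cylinders of some fixed length. -/
theorem exists_frequently_bounded {y₀ y₁ : ℕ → ℕ}
    (hy : ∀ h : ℕ → ℕ, SmallBelow z [] {x | y₀ x ≤ h (y₁ x)}) :
    ∃ r, ∃ᶠ l in prefixFilter r [], ∃ b, ∀ x ∈ cylinder z l, y₁ x ≤ b := by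
  by_contra! hcon
  -- One point is chosen for each pair `(l, k)` with `y₁` unbounded on the cylinder of `l`. Bounding
  -- `y₁` from below by the code of the pair makes `y₁` finite-to-one on the chosen points. The
  -- value `0` for other pairs is never used.
  have hpt : ∀ p : List ℕ × ℕ, ∃ x, (¬ ∃ b, ∀ x ∈ cylinder z p.1, y₁ x ≤ b) →
      x ∈ cylinder z p.1 ∧ Encodable.encode p ≤ y₁ x := by
    intro p
    by_cases hp : ∃ b, ∀ x ∈ cylinder z p.1, y₁ x ≤ b
    · exact ⟨0, fun h => (h hp).elim⟩
    · have hp' := hp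
      push Not at hp'
      obtain ⟨x, hx, hlt⟩ := hp' (Encodable.encode p)
      exact ⟨x, fun _ => ⟨hx, hlt.le⟩⟩
  choose x hx using hpt
  let A : Set ℕ := {t | ∃ p : List ℕ × ℕ, (¬ ∃ b, ∀ x ∈ cylinder z p.1, y₁ x ≤ b) ∧ x p = t}
  have hfin : ∀ k, {t ∈ A | y₁ t = k}.Finite := by
    intro k
    have hf : {p : List ℕ × ℕ | Encodable.encode p ≤ k}.Finite :=
      (Set.finite_Iic k).preimage Encodable.encode_injective.injOn
    refine (hf.image x).subset ?_
    rintro t ⟨⟨p, hp, rfl⟩, hk⟩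
    exact ⟨p, (hx p hp).2.trans hk.le, rfl⟩
  -- Finite fibres of `y₁` on `A` give `h` with `y₀ ≤ h ∘ y₁` on `A`, so `A` is small.
  have hbd : ∀ k, ∃ b, ∀ t ∈ A, y₁ t = k → y₀ t ≤ b := by
    intro k
    obtain ⟨b, hb⟩ := ((hfin k).image y₀).bddAbove
    exact ⟨b, fun t ht hk => hb ⟨t, ⟨ht, hk⟩, rfl⟩⟩
  choose h hh using hbd
  obtain ⟨q, hq⟩ := (hy h).mono (fun t ht => hh _ t ht rfl : A ⊆ _)
  have hunb := hcon q
  obtain ⟨l, hl, hlb⟩ := (hq.and hunb).exists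
  have hl' : ¬ ∃ b, ∀ x ∈ cylinder z l, y₁ x ≤ b := by
    push Not
    exact hlb
  obtain ⟨b, hb⟩ := (hl.image y₁).bddAbove
  have hsub : Set.range (fun k : ℕ => Encodable.encode (l, k)) ⊆ Set.Iic b := by
    rintro _ ⟨k, rfl⟩
    exact (hx (l, k) hl').2.trans (hb ⟨_, ⟨⟨_, hl', rfl⟩, (hx (l, k) hl').1⟩, rfl⟩)
  exact Set.infinite_range_of_injective
    (fun k k' e => (Prod.ext_iff.1 (Encodable.encode_injective e)).2) ((Set.finite_Iic b).subset hsub)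

/-- There is no sequence of functions `y i` such that, for all `m`, the functions
`y (m - 1), …, y 0` reduce `Fin^m` to the ideal of small sets. -/
theorem not_forall_smallBelow_preimage (hz : ∀ l, (cylinder z l).Infinite) (y : ℕ → ℕ → ℕ) :
    ¬ ∀ m, ∀ T ∈ finPow (m + 1),
      SmallBelow z [] {x | (fun i : Fin (m + 1) => y (m - i) x) ∈ T} := by
  intro H
  have h01 : ∀ h : ℕ → ℕ, SmallBelow z [] {x | y 0 x ≤ h (y 1 x)} := fun h => by
    simpa using H 1 _ (finPow_coord_le_zero (0 : Fin 1) h)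
  obtain ⟨r, hr⟩ := exists_frequently_bounded h01
  -- In the tuple `(y i, …, y 0)` the entry `y 1` has position `i - 1`, the successor of `i - 2`.
  have h1i : ∀ i, 2 ≤ i → SmallBelow z [] {x | y 1 x ≤ y i x} := fun i hi => by
    refine (H i _ (finPow_coord_le_zero (⟨i - 2, by omega⟩ : Fin i) id)).mono fun x hx => ?_
    have e : i - (i - 2 + 1) = 1 := by omega
    simpa [e] using hx
  let u : ℕ → Fin (r + 1) → ℕ := fun x i => y (r + 1 - i) x
  have hsmall : SmallBelow z [] (⋃ i ∈ Set.Icc 2 (r + 1), {x | y 1 x ≤ y i x}) :=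
    SmallBelow.biUnion (Set.finite_Icc _ _) fun i hi => h1i i hi.1
  have hval : ∃ᶠ l in prefixFilter r [], ∃ c, ¬ SmallBelow z l {x | u x = c} := by
    refine (hr.and_eventually (hsmall.eventually r)).mono ?_
    rintro l ⟨⟨b, hb⟩, hl⟩
    by_contra! hcon
    have hfin : {c : Fin (r + 1) → ℕ | ∀ i, c i ≤ b}.Finite := by
      refine (Set.finite_Iic (fun _ : Fin (r + 1) => b)).subset fun c hc => hc
    refine not_smallBelow_cylinder hz l
      ((hl.union (SmallBelow.biUnion hfin fun c _ => hcon c)).mono fun x hx => ?_)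
    by_cases hxi : ∃ i ∈ Set.Icc 2 (r + 1), y 1 x ≤ y i x
    · obtain ⟨i, hi, hle⟩ := hxi
      exact Or.inl (Set.mem_biUnion hi hle)
    · refine Or.inr (Set.mem_biUnion (x := u x) (fun i => ?_) rfl)
      push Not at hxi
      have hi := i.isLt
      -- An entry of `u` is either `y 1`, bounded by `b` on the cylinder, or some `y j` with `2 ≤ j
      -- ≤ r + 1`, which lies below `y 1` off the small set.
      rcases Nat.lt_or_ge (r + 1 - i) 2 with h2 | h2
      · have e : r + 1 - (i : ℕ) = 1 := by omega
        simpa [u, e] using hb x hx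
      · exact ((hxi _ ⟨h2, by omega⟩).trans_le (hb x hx)).le
  choose! c hc using fun l (h : ∃ c, ¬ SmallBelow z l {x | u x = c}) => h
  obtain ⟨E, hED, hE, hcE⟩ := exists_frequently_image_mem_finPow (Nat.lt_succ_self r) []
    {l | ∃ c, ¬ SmallBelow z l {x | u x = c}} c hval
  -- `u` is the tuple `(y (r+1), …, y 0)` without its last entry, hence `finPow_init`.
  have hu : SmallBelow z [] {x | u x ∈ c '' E} := H (r + 1) _ (finPow_init hcE)
  obtain ⟨l, hlE, hl⟩ := (hE.and_eventually (hu.eventually r)).exists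
  refine hc l (hED hlE) (hl.mono fun x hx => ?_)
  have hx' : u x = c l := hx
  exact ⟨l, hlE, hx'.symm⟩

end SmallBelow

/-! ### Enumeration of the coordinates of a family of partitions -/

/-- The successor of a pair in the enumeration `(0, 0), (1, 0), (1, 1), (2, 0), …` of the pairs
`(n, i)` with `i ≤ n`. -/
def triangleNext (p : Σ n : ℕ, Fin (n + 1)) : Σ n : ℕ, Fin (n + 1) :=
  if h : (p.2 : ℕ) < p.1 then ⟨p.1, ⟨p.2 + 1, by omega⟩⟩ else ⟨p.1 + 1, 0⟩

/-- The enumeration `(0, 0), (1, 0), (1, 1), (2, 0), …` of the pairs `(n, i)` with `i ≤ n`. -/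
def triangleIndex : ℕ → Σ n : ℕ, Fin (n + 1)
  | 0 => ⟨0, 0⟩
  | k + 1 => triangleNext (triangleIndex k)

/-- The position of `(n, 0)` in the enumeration `triangleIndex`. -/
def triangleStart : ℕ → ℕ
  | 0 => 0
  | n + 1 => triangleStart n + (n + 1)

theorem triangleStart_add_triangleIndex (k : ℕ) :
    triangleStart (triangleIndex k).1 + (triangleIndex k).2 = k := by
  induction k with
  | zero => rfl
  | succ k ih =>
    rw [triangleIndex]
    generalize triangleIndex k = p at ih ⊢
    obtain ⟨n, i⟩ := p
    have := i.isLt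
    by_cases h : (i : ℕ) < n
    · have e : triangleNext ⟨n, i⟩ = ⟨n, ⟨i + 1, by omega⟩⟩ := dif_pos h
      rw [e]
      change triangleStart n + (i + 1) = k + 1
      change triangleStart n + i = k at ih
      omega
    · have e : triangleNext ⟨n, i⟩ = ⟨n + 1, 0⟩ := dif_neg h
      rw [e]
      change triangleStart n + (n + 1) + 0 = k + 1
      change triangleStart n + i = k at ih
      omega

theorem triangleIndex_triangleStart_add (n i : ℕ) (hi : i < n + 1) :
    triangleIndex (triangleStart n + i) = ⟨n, ⟨i, hi⟩⟩ := by
  induction n generalizing i with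
  | zero =>
    obtain rfl : i = 0 := by omega
    rfl
  | succ n ihn =>
    induction i with
    | zero =>
      have h := ihn n (Nat.lt_succ_self n)
      change triangleIndex (triangleStart n + n + 1) = _
      rw [triangleIndex, h]
      simp [triangleNext]
    | succ i ihi =>
      have h := ihi (by omega)
      change triangleIndex (triangleStart (n + 1) + i + 1) = _
      rw [triangleIndex, h]
      have : i < n + 1 := by omega
      simp [triangleNext, this]

/-! ### Cylinders of an independent family, and smallness of the members of `Fin'_ω`. -/

namespace IsIndependentPartitionFamily

variable {X : (n : ℕ) → (Fin (n + 1) → ℕ) → Set ℕ}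

theorem exists_mem (hX : IsIndependentPartitionFamily X) (n x : ℕ) : ∃ s, x ∈ X n s := by
  have h : x ∈ ⋃ s, X n s := hX.cover n ▸ Set.mem_univ x
  exact Set.mem_iUnion.1 h

/-- The index of the member of the `n`-th partition that contains `x`. -/
noncomputable def index (hX : IsIndependentPartitionFamily X) (n x : ℕ) : Fin (n + 1) → ℕ :=
  (hX.exists_mem n x).choose

theorem mem_index (hX : IsIndependentPartitionFamily X) (n x : ℕ) : x ∈ X n (hX.index n x) :=
  (hX.exists_mem n x).choose_spec

theorem index_eq (hX : IsIndependentPartitionFamily X) {n x : ℕ} {s : Fin (n + 1) → ℕ}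
    (h : x ∈ X n s) : hX.index n x = s := by
  by_contra hne
  exact Set.disjoint_left.1 (hX.disjoint n _ _ hne) (hX.mem_index n x) h

/-- The coordinates of the indices of `x` in all the partitions, in one sequence. -/
noncomputable def coord (hX : IsIndependentPartitionFamily X) (k x : ℕ) : ℕ :=
  hX.index (triangleIndex k).1 x (triangleIndex k).2

theorem cylinder_coord_infinite (hX : IsIndependentPartitionFamily X) (l : List ℕ) :
    (cylinder hX.coord l).Infinite := by
  -- Only finitely many partitions are involved in the entries of `l`, so independence applies;
  -- index entries beyond the end of `l` are filled with `0`.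
  refine (hX.infinite_inter ((Finset.range l.length).image fun k => (triangleIndex k).1)
    fun n i => l.getD (triangleStart n + i) 0).mono fun x hx k hk => ?_
  rw [Set.mem_iInter₂] at hx
  have h := hX.index_eq (hx (triangleIndex k).1
    (Finset.mem_image_of_mem (fun k => (triangleIndex k).1) (Finset.mem_range.2 hk)))
  rw [coord, h]
  change l.getD (triangleStart (triangleIndex k).1 + (triangleIndex k).2) 0 = l[k]
  rw [triangleStart_add_triangleIndex]
  simp [hk]

theorem smallBelow_of_mem_finPowCopy (hX : IsIndependentPartitionFamily X) {n : ℕ} {A : Set ℕ}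
    (hA : A ∈ finPowCopy n (X n)) : SmallBelow hX.coord [] A := by
  obtain ⟨σ, hσ, hA⟩ := hA
  -- The first `triangleStart n` entries belong to earlier partitions and are arbitrary. The next `n
  -- + 1` spell an index `v`, so the cylinder lies in `X n v`.
  refine ⟨triangleStart n + (n + 1), ?_⟩
  rw [eventually_prefixFilter_add]
  filter_upwards [eventually_prefixFilter_prefix (triangleStart n) []] with l hl
  have hlen : l.length = triangleStart n := by simpa using hl.2
  refine eventually_prefixFilter_of_finPow (finPow_infinite_fibers hA) fun v hv => ?_
  have hv' : {b : ℕ | σ (Fin.snoc v b : Fin (n + 2) → ℕ) ∈ A}.Finite := Set.not_infinite.1 hv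
  refine (hv'.image fun b => σ (Fin.snoc v b : Fin (n + 2) → ℕ)).subset ?_
  rintro x ⟨hxA, hx⟩
  have hindex : hX.index n x = v := by
    ext i
    have h := hx (triangleStart n + i) (by simp [hlen]; omega)
    rw [coord, triangleIndex_triangleStart_add n i i.isLt] at h
    simpa [← hlen, -List.ofFn_succ] using h
  have hmem : x ∈ X n v := hindex ▸ hX.mem_index n x
  rw [← hσ v] at hmem
  obtain ⟨w, hw, rfl⟩ := hmem
  have hw' : (Fin.snoc v (w (Fin.last _)) : Fin (n + 2) → ℕ) = w := by
    rw [← (hw : (Fin.init w : Fin (n + 1) → ℕ) = v)]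
    exact Fin.snoc_init_self w
  exact ⟨w (Fin.last _), by rw [Set.mem_ofPred_eq, hw']; exact hxA, by simp only [hw']⟩

theorem smallBelow_of_mem_finOmega' (hX : IsIndependentPartitionFamily X) {A : Set ℕ}
    (hA : A ∈ finOmega' X) : SmallBelow hX.coord [] A := by
  obtain ⟨n, F, hF, hAF⟩ := hA
  refine (SmallBelow.biUnion (S := Set.univ) Set.finite_univ (A := F) fun k _ => ?_).mono
    (by simpa using hAF)
  obtain ⟨j, hj⟩ := Set.mem_iUnion.1 (hF k)
  exact hX.smallBelow_of_mem_finPowCopy hj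

end IsIndependentPartitionFamily

/-! ### From a copy of `Fin_ω` to coordinate functions. -/

theorem mem_finOmega_of_mem_finPow {m : ℕ} {T : Set (Fin (m + 1) → ℕ)}
    (hT : T ∈ finPow (m + 1)) :
    {p : Σ i : ℕ+, (Fin (i : ℕ) → ℕ) |
      ∀ h : m + 1 ≤ (p.1 : ℕ), lastCoords (m + 1) p.1 h p.2 ∈ T} ∈ finOmega := by
  refine ⟨⟨m + 1, m.succ_pos⟩, Tᶜ, ?_, ?_⟩
  · change Tᶜᶜ ∈ finPow (m + 1)
    rwa [compl_compl]
  · refine Set.eq_empty_of_forall_notMem ?_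
    rintro p ⟨hp, h, hpT⟩
    exact hpT (hp h)

theorem theorem4p6 (X : (n : ℕ) → (Fin (n + 1) → ℕ) → Set ℕ)
    (hX : IsIndependentPartitionFamily X) :
    ¬ ContainsCopy (finOmega' X) finOmega := by
  rintro ⟨f, hf⟩
  refine not_forall_smallBelow_preimage hX.cylinder_coord_infinite
    -- Coordinates are counted from the end. The default `0` is harmless: points `f x` with at most
    -- `m` coordinates belong to the set of `mem_finOmega_of_mem_finPow` in any case.
    (fun i x => if h : i < ((f x).1 : ℕ) then (f x).2 ⟨(f x).1 - 1 - i, by omega⟩ else 0) ?_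
  intro m T hT
  refine (hX.smallBelow_of_mem_finOmega' (hf _ (mem_finOmega_of_mem_finPow hT))).mono ?_
  intro x hx h
  refine Set.mem_of_eq_of_mem (funext fun i => ?_) hx
  have hi := i.isLt
  have hlt : m - (i : ℕ) < ((f x).1 : ℕ) := by omega
  simp only [lastCoords, dif_pos hlt]
  refine congrArg (f x).2 (Fin.ext ?_)
  simp only
  omega
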